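/- Let $X$ be a locally compact, Hausdorff, second countable, totally disconnected space (for example the Cantor set). An étale equivalence relation on $X$ is an equivalence relation $R$ on $X$ with a locally compact, Hausdorff, second countable topology which makes it a topological groupoid with unit space $X$ (where $(x,y)(y,z)=(x,z)$, $(x,y)^{-1}=(y,x)$ and $x\in X$ is identified with $(x,x)$) and for which $R\to X$, $(x,y)\mapsto x$, is a local homeomorphism. It is compact (a CEER) if $\{(x,y)\in R : x\neq y\}$ is compact. It is an AF-relation if $R=\bigcup_n R_n$ for a sequence of CEERs $R_1\subseteq R_2\subseteq\cdots$ on $X$ such that each $R_n$, with its own topology, is an open subspace of $R_{n+1}$, and $R$ carries the inductive limit topology. A twist over a locally compact Hausdorff étale groupoid $G$ with unit space $G^{0}$ is a locally compact Hausdorff topological groupoid $\Sigma$ with unit space $G^{0}$ together with a central extension $\mathbb{T}\times G^{0}\to\Sigma\to G$ of topological groupoids over the identity of $G^{0}$, where $\mathbb T$ is the circle group, $\mathbb{T}\times G^{0}\to\Sigma$ is injective with image the preimage of $G^{0}$ in $\Sigma$ (so that $\mathbb{T}$ acts freely on $\Sigma$), and $\Sigma\to G$ induces a homeomorphism $\Sigma/\mathbb{T}\cong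 G$. The twist is trivial if it is isomorphic to $G\times\mathbb{T}$ as a twist, i.e. if there is an isomorphism of topological groupoids $\Sigma\cong G\times\mathbb{T}$ compatible with the maps from $\mathbb{T}\times G^{0}$ and with the maps to $G$. **Proposition.** If $G$ is an AF-relation on $X$, then every twist $\Sigma$ over $G$ is trivial. -/

import Mathlib

open Topology

/-- A topological groupoid with unit space `X` and space of arrows `G`. An arrow `g` goes from
`src g` to `tgt g`, and the product `g h` is defined when `src g = tgt h`. -/
structure TopologicalGroupoid (X G : Type*) [TopologicalSpace X] [TopologicalSpace G] where
  src : G → X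
  tgt : G → X
  unit : X → G
  inv : G → G
  mul : ∀ g h : G, src g = tgt h → G
  src_unit : ∀ x, src (unit x) = x
  tgt_unit : ∀ x, tgt (unit x) = x
  src_inv : ∀ g, src (inv g) = tgt g
  tgt_inv : ∀ g, tgt (inv g) = src g
  src_mul : ∀ g h (e : src g = tgt h), src (mul g h e) = src h
  tgt_mul : ∀ g h (e : src g = tgt h), tgt (mul g h e) = tgt g
  mul_assoc : ∀ g h k (e : src g = tgt h) (e' : src h = tgt k),
    mul (mul g h e) k ((src_mul g h e).trans e') = mul g (mul h k e') (e.trans (tgt_mul h k e').symm)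
  unit_mul : ∀ g, mul (unit (tgt g)) g (src_unit _) = g
  mul_unit : ∀ g, mul g (unit (src g)) (tgt_unit _).symm = g
  inv_mul : ∀ g, mul (inv g) g (src_inv g) = unit (src g)
  mul_inv : ∀ g, mul g (inv g) (tgt_inv g).symm = unit (tgt g)
  continuous_src : Continuous src
  continuous_tgt : Continuous tgt
  continuous_unit : Continuous unit
  continuous_inv : Continuous inv
  continuous_mul : Continuous fun p : {p : G × G // src p.1 = tgt p.2} => mul p.1.1 p.1.2 p.2

/-! ### Étale and AF equivalence relations -/

/-- The pairs `(tgt, src)` of equivalent points, i.e. the equivalence relation `r` as a set. It is a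
type of its own so that it does not inherit the topology of `X × X`. -/
@[ext]
structure RelPair {X : Type*} (r : Setoid X) where
  tgt : X
  src : X
  rel : r tgt src

namespace RelPair

variable {X : Type*} {r s : Setoid X}

/-- The diagonal pair `(x, x)`. -/
def diag (r : Setoid X) (x : X) : RelPair r := ⟨x, x, r.refl x⟩

/-- The inverse `(x, y)⁻¹ = (y, x)`. -/
def inv (p : RelPair r) : RelPair r := ⟨p.src, p.tgt, r.symm p.rel⟩

/-- The product `(x, y) (y, z) = (x, z)`. -/
def mul (p q : RelPair r) (e : p.src = q.tgt) : RelPair r :=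
  ⟨p.tgt, q.src, r.trans p.rel (e ▸ q.rel)⟩

/-- The inclusion of a subrelation. -/
def inclusion (h : r ≤ s) (p : RelPair r) : RelPair s := ⟨p.tgt, p.src, h p.rel⟩

end RelPair

/-- An étale equivalence relation on `X`: an equivalence relation with a locally compact, Hausdorff,
second countable topology (in general not the one of `X × X`) that makes it a topological groupoid
with unit space `X` whose range map is a local homeomorphism. -/
structure EtaleEquivRel (X : Type*) [TopologicalSpace X] where
  rel : Setoid X
  topology : TopologicalSpace (RelPair rel)
  t2Space : T2Space (RelPair rel)
  locallyCompactSpace : LocallyCompactSpace (RelPair rel)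
  secondCountableTopology : SecondCountableTopology (RelPair rel)
  continuous_diag : Continuous (RelPair.diag rel)
  continuous_inv : Continuous (RelPair.inv : RelPair rel → RelPair rel)
  continuous_mul : Continuous fun p : {p : RelPair rel × RelPair rel // p.1.src = p.2.tgt} =>
    RelPair.mul p.1.1 p.1.2 p.2
  isLocalHomeomorph_tgt : IsLocalHomeomorph (RelPair.tgt : RelPair rel → X)

attribute [instance] EtaleEquivRel.topology EtaleEquivRel.t2Space EtaleEquivRel.locallyCompactSpace
  EtaleEquivRel.secondCountableTopology

namespace EtaleEquivRel

variable {X : Type*} [TopologicalSpace X]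

/-- An étale equivalence relation as a topological groupoid. -/
def groupoid (R : EtaleEquivRel X) : TopologicalGroupoid X (RelPair R.rel) where
  src := RelPair.src
  tgt := RelPair.tgt
  unit := RelPair.diag R.rel
  inv := RelPair.inv
  mul := RelPair.mul
  src_unit _ := rfl
  tgt_unit _ := rfl
  src_inv _ := rfl
  tgt_inv _ := rfl
  src_mul _ _ _ := rfl
  tgt_mul _ _ _ := rfl
  mul_assoc _ _ _ _ _ := rfl
  unit_mul _ := rfl
  mul_unit _ := rfl
  inv_mul _ := rfl
  mul_inv _ := rfl
  continuous_src := R.isLocalHomeomorph_tgt.continuous.comp R.continuous_inv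
  continuous_tgt := R.isLocalHomeomorph_tgt.continuous
  continuous_unit := R.continuous_diag
  continuous_inv := R.continuous_inv
  continuous_mul := R.continuous_mul

/-- `R` is a compact étale equivalence relation (CEER): its off-diagonal part is compact. (If `X` is
compact, this says that `R` is compact.) -/
def IsCEER (R : EtaleEquivRel X) : Prop :=
  IsCompact {p : RelPair R.rel | p.tgt ≠ p.src}

/-- `R` is an AF-relation: the inductive limit, as a set and as a topological space, of a sequence of
compact étale equivalence relations `K n`, where each `K n`, with its topology, is an open
subrelation of `K (n + 1)`. -/
def IsAF (R : EtaleEquivRel X) : Prop :=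
  ∃ (K : ℕ → EtaleEquivRel X) (mono : ∀ n, (K n).rel ≤ (K (n + 1)).rel)
    (le : ∀ n, (K n).rel ≤ R.rel),
    (∀ n, (K n).IsCEER) ∧
    (∀ n, IsOpenEmbedding (RelPair.inclusion (mono n))) ∧
    (∀ x y, R.rel x y → ∃ n, (K n).rel x y) ∧
    ∀ U : Set (RelPair R.rel), IsOpen U ↔ ∀ n, IsOpen (RelPair.inclusion (le n) ⁻¹' U)

end EtaleEquivRel

/-! ### Twists -/

/-- A twist over the topological groupoid `𝒢`: a locally compact Hausdorff topological groupoid with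
space of arrows `S` and with the same unit space `X`, together with a central extension
`Circle × X → S → 𝒢` of topological groupoids, where `S / Circle ≅ 𝒢`. -/
structure Twist {X G : Type*} [TopologicalSpace X] [TopologicalSpace G]
    (𝒢 : TopologicalGroupoid X G) (S : Type*) [TopologicalSpace S] where
  groupoid : TopologicalGroupoid X S
  t2Space : T2Space S
  locallyCompactSpace : LocallyCompactSpace S
  /-- The inclusion of the trivial bundle of groups `Circle × X`. -/
  incl : Circle × X → S
  /-- The projection onto `𝒢`. -/
  proj : S → G
  src_incl : ∀ z x, groupoid.src (incl (z, x)) = x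
  tgt_incl : ∀ z x, groupoid.tgt (incl (z, x)) = x
  incl_mul : ∀ z w x, incl (z * w, x) =
    groupoid.mul (incl (z, x)) (incl (w, x)) ((src_incl z x).trans (tgt_incl w x).symm)
  continuous_incl : Continuous incl
  injective_incl : Function.Injective incl
  src_proj : ∀ s, 𝒢.src (proj s) = groupoid.src s
  tgt_proj : ∀ s, 𝒢.tgt (proj s) = groupoid.tgt s
  proj_mul : ∀ s t (e : groupoid.src s = groupoid.tgt t), proj (groupoid.mul s t e) =
    𝒢.mul (proj s) (proj t) ((src_proj s).trans (e.trans (tgt_proj t).symm))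
  /-- The projection is a quotient map. As its fibres are the orbits of `Circle`, it identifies
  `S / Circle` with `𝒢`. -/
  isQuotientMap_proj : IsQuotientMap proj
  /-- Exactness: the kernel of the projection is the image of the inclusion. -/
  exact : ∀ s, (∃ x, proj s = 𝒢.unit x) ↔ s ∈ Set.range incl
  /-- The extension is central. -/
  central : ∀ z s, groupoid.mul (incl (z, groupoid.tgt s)) s (src_incl _ _) =
    groupoid.mul s (incl (z, groupoid.src s)) (tgt_incl _ _).symm

namespace Twist

variable {X G : Type*} [TopologicalSpace X] [TopologicalSpace G]

/-- The groupoid `𝒢 × Circle`. -/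
noncomputable def prodCircle (𝒢 : TopologicalGroupoid X G) : TopologicalGroupoid X (G × Circle) where
  src p := 𝒢.src p.1
  tgt p := 𝒢.tgt p.1
  unit x := (𝒢.unit x, 1)
  inv p := (𝒢.inv p.1, p.2⁻¹)
  mul p q e := (𝒢.mul p.1 q.1 e, p.2 * q.2)
  src_unit _ := 𝒢.src_unit _
  tgt_unit _ := 𝒢.tgt_unit _
  src_inv _ := 𝒢.src_inv _
  tgt_inv _ := 𝒢.tgt_inv _
  src_mul _ _ _ := 𝒢.src_mul _ _ _
  tgt_mul _ _ _ := 𝒢.tgt_mul _ _ _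
  mul_assoc _ _ _ _ _ := Prod.ext (𝒢.mul_assoc _ _ _ _ _) (mul_assoc _ _ _)
  unit_mul _ := Prod.ext (𝒢.unit_mul _) (one_mul _)
  mul_unit _ := Prod.ext (𝒢.mul_unit _) (mul_one _)
  inv_mul _ := Prod.ext (𝒢.inv_mul _) (inv_mul_cancel _)
  mul_inv _ := Prod.ext (𝒢.mul_inv _) (mul_inv_cancel _)
  continuous_src := 𝒢.continuous_src.comp continuous_fst
  continuous_tgt := 𝒢.continuous_tgt.comp continuous_fst
  continuous_unit := 𝒢.continuous_unit.prodMk continuous_const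
  continuous_inv := (𝒢.continuous_inv.comp continuous_fst).prodMk continuous_snd.inv
  continuous_mul := by
    refine Continuous.prodMk ?_ (by fun_prop)
    exact 𝒢.continuous_mul.comp (Continuous.subtype_mk (f := fun p :
      {p : (G × Circle) × (G × Circle) // 𝒢.src p.1.1 = 𝒢.tgt p.2.1} => (p.1.1.1, p.1.2.1))
      (by fun_prop) fun p => p.2)

/-- The trivial twist `𝒢 × Circle` over `𝒢`. -/
noncomputable def trivial (𝒢 : TopologicalGroupoid X G) [T2Space G] [LocallyCompactSpace G] :
    Twist 𝒢 (G × Circle) where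
  groupoid := prodCircle 𝒢
  t2Space := inferInstance
  locallyCompactSpace := inferInstance
  incl p := (𝒢.unit p.2, p.1)
  proj p := p.1
  src_incl _ _ := 𝒢.src_unit _
  tgt_incl _ _ := 𝒢.tgt_unit _
  incl_mul _ _ x := Prod.ext (by
    have h := 𝒢.unit_mul (𝒢.unit x)
    simp only [𝒢.tgt_unit] at h
    exact h.symm) rfl
  continuous_incl := (𝒢.continuous_unit.comp continuous_snd).prodMk continuous_fst
  injective_incl := fun p q h => by
    have h1 := congrArg (fun u => 𝒢.src u.1) h
    simp only [𝒢.src_unit] at h1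
    exact Prod.ext (congrArg Prod.snd h) h1
  src_proj _ := rfl
  tgt_proj _ := rfl
  proj_mul _ _ _ := rfl
  isQuotientMap_proj := isOpenMap_fst.isQuotientMap continuous_fst Prod.fst_surjective
  exact s := ⟨fun ⟨x, hx⟩ => ⟨(s.2, x), Prod.ext hx.symm rfl⟩, fun ⟨p, hp⟩ => ⟨p.2, by rw [← hp]⟩⟩
  central z s := Prod.ext ((𝒢.unit_mul s.1).trans (𝒢.mul_unit s.1).symm) (mul_comm z s.2)

/-- An isomorphism of twists over `𝒢`: a homeomorphic isomorphism of groupoids that is compatible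
with the inclusions of `Circle × X` and with the projections onto `𝒢`. -/
structure Iso {𝒢 : TopologicalGroupoid X G} {S S' : Type*} [TopologicalSpace S]
    [TopologicalSpace S'] (E : Twist 𝒢 S) (E' : Twist 𝒢 S') where
  toHomeomorph : S ≃ₜ S'
  src_map : ∀ s, E'.groupoid.src (toHomeomorph s) = E.groupoid.src s
  tgt_map : ∀ s, E'.groupoid.tgt (toHomeomorph s) = E.groupoid.tgt s
  map_mul : ∀ s t (e : E.groupoid.src s = E.groupoid.tgt t),
    toHomeomorph (E.groupoid.mul s t e) = E'.groupoid.mul (toHomeomorph s) (toHomeomorph t)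
      ((src_map s).trans (e.trans (tgt_map t).symm))
  map_incl : ∀ p, toHomeomorph (E.incl p) = E'.incl p
  proj_map : ∀ s, E'.proj (toHomeomorph s) = E.proj s

/-- A twist is trivial if it is isomorphic to `𝒢 × Circle`. -/
def IsTrivial {𝒢 : TopologicalGroupoid X G} [T2Space G] [LocallyCompactSpace G] {S : Type*}
    [TopologicalSpace S] (E : Twist 𝒢 S) : Prop :=
  Nonempty (Iso E (trivial 𝒢))

end Twist

/-! A twist splits once its projection has a continuous multiplicative section
(`isTrivial_of_section`). Over a single CEER `K n`, such a section is a coboundary: a continuous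
selector `f n` of one point per class (`IsCEER.exists_selector`) and a continuous lift `c n x` of
the arrow `(x, f n x)` give `(x, y) ↦ c n x * (c n y)⁻¹`. For the AF-relation the sections must
agree. If `d` lifts `x ↦ (x, f (n + 1) x)`, put `c (n + 1) x = c n x * d (f n x)`: the new factor
depends only on the `K n`-class of `x`, so it cancels in the quotient. The common extension is
continuous by the inductive limit topology. The lifts exist (`exists_lift`) because the projection
has continuous local sections, which patch over clopen sets of the zero-dimensional space `X`. -/

namespace TopologicalGroupoid

/-! ### Algebra in topological groupoids -/

variable {X G : Type*} [TopologicalSpace X] [TopologicalSpace G] (𝒢 : TopologicalGroupoid X G)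

/-- The composability proof depends on the factors, so they cannot simply be rewritten inside `mul`.
-/
theorem mul_congr {g g' h h' : G} (hg : g = g') (hh : h = h') (e : 𝒢.src g = 𝒢.tgt h) :
    𝒢.mul g h e = 𝒢.mul g' h' (hg ▸ hh ▸ e) := by
  subst hg hh
  rfl

/-- The quotient `g h⁻¹` of two arrows with the same source. -/
def div (g h : G) (e : 𝒢.src g = 𝒢.src h) : G :=
  𝒢.mul g (𝒢.inv h) (e.trans (𝒢.tgt_inv h).symm)

variable {𝒢} {g h k : G}

theorem unit_mul' {x : X} (e : 𝒢.src (𝒢.unit x) = 𝒢.tgt g) : 𝒢.mul (𝒢.unit x) g e = g := by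
  obtain rfl : x = 𝒢.tgt g := (𝒢.src_unit x).symm.trans e
  exact 𝒢.unit_mul g

theorem mul_unit' {x : X} (e : 𝒢.src g = 𝒢.tgt (𝒢.unit x)) : 𝒢.mul g (𝒢.unit x) e = g := by
  obtain rfl : 𝒢.src g = x := e.trans (𝒢.tgt_unit x)
  exact 𝒢.mul_unit g

@[simp]
theorem tgt_div (e : 𝒢.src g = 𝒢.src h) : 𝒢.tgt (𝒢.div g h e) = 𝒢.tgt g :=
  𝒢.tgt_mul _ _ _

@[simp]
theorem src_div (e : 𝒢.src g = 𝒢.src h) : 𝒢.src (𝒢.div g h e) = 𝒢.tgt h :=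
  (𝒢.src_mul _ _ _).trans (𝒢.src_inv h)

theorem div_self (g : G) : 𝒢.div g g rfl = 𝒢.unit (𝒢.tgt g) :=
  𝒢.mul_inv g

theorem div_mul_cancel (e : 𝒢.src g = 𝒢.src h) : 𝒢.mul (𝒢.div g h e) h (src_div e) = g := by
  unfold div
  rw [𝒢.mul_assoc g (𝒢.inv h) h _ (𝒢.src_inv h), 𝒢.mul_congr rfl (𝒢.inv_mul h), mul_unit']

theorem eq_div_of_mul_eq {a : G} (e : 𝒢.src a = 𝒢.tgt h) (H : 𝒢.mul a h e = g) :
    a = 𝒢.div g h (H ▸ 𝒢.src_mul a h e) := by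
  subst H
  unfold div
  rw [𝒢.mul_assoc a h (𝒢.inv h) e (𝒢.tgt_inv h).symm, 𝒢.mul_congr rfl (𝒢.mul_inv h), mul_unit']

theorem mul_right_cancel {a b : G} {ea : 𝒢.src a = 𝒢.tgt h} {eb : 𝒢.src b = 𝒢.tgt h}
    (H : 𝒢.mul a h ea = 𝒢.mul b h eb) : a = b :=
  (eq_div_of_mul_eq ea H).trans (eq_div_of_mul_eq eb rfl).symm

theorem div_mul_div (e : 𝒢.src g = 𝒢.src h) (e' : 𝒢.src h = 𝒢.src k) :
    𝒢.mul (𝒢.div g h e) (𝒢.div h k e') ((src_div e).trans (tgt_div e').symm) =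
      𝒢.div g k (e.trans e') := by
  apply eq_div_of_mul_eq ((𝒢.src_mul _ _ _).trans (src_div e'))
  rw [𝒢.mul_assoc _ _ _ _ (src_div e'), 𝒢.mul_congr rfl (div_mul_cancel e'), div_mul_cancel]

/-- This cancellation makes the sections over `K n` and `K (n + 1)` agree. -/
theorem mul_div_mul_right (eg : 𝒢.src g = 𝒢.tgt k) (eh : 𝒢.src h = 𝒢.tgt k) :
    𝒢.div (𝒢.mul g k eg) (𝒢.mul h k eh) ((𝒢.src_mul _ _ _).trans (𝒢.src_mul _ _ _).symm) =
      𝒢.div g h (eg.trans eh.symm) := by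
  refine (eq_div_of_mul_eq ((src_div _).trans (𝒢.tgt_mul _ _ _).symm) ?_).symm
  rw [← 𝒢.mul_assoc _ _ _ (src_div (eg.trans eh.symm)) eh, 𝒢.mul_congr (div_mul_cancel _) rfl]

theorem eq_unit_of_mul_self (e : 𝒢.src g = 𝒢.tgt g) (H : 𝒢.mul g g e = g) :
    g = 𝒢.unit (𝒢.tgt g) :=
  (eq_div_of_mul_eq e H).trans (div_self g)

theorem continuous_mul' {Y : Type*} [TopologicalSpace Y] {a b : Y → G} (ha : Continuous a)
    (hb : Continuous b) (e : ∀ y, 𝒢.src (a y) = 𝒢.tgt (b y)) :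
    Continuous fun y => 𝒢.mul (a y) (b y) (e y) :=
  𝒢.continuous_mul.comp ((ha.prodMk hb).subtype_mk e)

theorem continuous_div {Y : Type*} [TopologicalSpace Y] {a b : Y → G} (ha : Continuous a)
    (hb : Continuous b) (e : ∀ y, 𝒢.src (a y) = 𝒢.src (b y)) :
    Continuous fun y => 𝒢.div (a y) (b y) (e y) :=
  continuous_mul' ha (𝒢.continuous_inv.comp hb) _

end TopologicalGroupoid

/-! ### The circle action on a twist -/

namespace Twist

open TopologicalGroupoid

variable {X G S : Type*} [TopologicalSpace X] [TopologicalSpace G] [TopologicalSpace S]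
  {𝒢 : TopologicalGroupoid X G} (E : Twist 𝒢 S)

/-- The action of the circle on the arrows of a twist. -/
def smul (z : Circle) (s : S) : S :=
  E.groupoid.mul (E.incl (z, E.groupoid.tgt s)) s (E.src_incl _ _)

variable {E} {s t : S} {z w : Circle}

@[simp]
theorem src_smul : E.groupoid.src (E.smul z s) = E.groupoid.src s :=
  E.groupoid.src_mul _ _ _

@[simp]
theorem tgt_smul : E.groupoid.tgt (E.smul z s) = E.groupoid.tgt s :=
  (E.groupoid.tgt_mul _ _ _).trans (E.tgt_incl _ _)

theorem proj_incl (x : X) : E.proj (E.incl (z, x)) = 𝒢.unit x := by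
  obtain ⟨y, hy⟩ := (E.exact (E.incl (z, x))).2 ⟨_, rfl⟩
  have h := congrArg 𝒢.src hy
  rw [E.src_proj, E.src_incl, 𝒢.src_unit] at h
  rw [hy, h]

@[simp]
theorem proj_smul : E.proj (E.smul z s) = E.proj s := by
  unfold smul
  rw [E.proj_mul, 𝒢.mul_congr (proj_incl _) rfl, unit_mul']

theorem incl_one (x : X) : E.incl (1, x) = E.groupoid.unit x := by
  have h := E.incl_mul 1 1 x
  rw [mul_one] at h
  have h' := eq_unit_of_mul_self _ h.symm
  rwa [E.tgt_incl] at h'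

theorem mul_smul : E.smul (z * w) s = E.smul z (E.smul w s) := by
  have h : E.smul z (E.smul w s) = E.groupoid.mul (E.incl (z, E.groupoid.tgt s))
      (E.smul w s) ((E.src_incl _ _).trans tgt_smul.symm) :=
    E.groupoid.mul_congr (by rw [tgt_smul]) rfl _
  rw [h]
  unfold smul
  rw [E.groupoid.mul_congr (E.incl_mul z w _) rfl]
  exact E.groupoid.mul_assoc _ _ _ _ _

theorem smul_mul (e : E.groupoid.src s = E.groupoid.tgt t) :
    E.groupoid.mul (E.smul z s) t (src_smul.trans e) = E.smul z (E.groupoid.mul s t e) := by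
  unfold smul
  rw [E.groupoid.mul_assoc _ s t (E.src_incl _ _) e]
  exact E.groupoid.mul_congr (by rw [E.groupoid.tgt_mul]) rfl _

theorem smul_eq_mul_incl (z : Circle) (s : S) :
    E.smul z s = E.groupoid.mul s (E.incl (z, E.groupoid.src s)) (E.tgt_incl _ _).symm :=
  E.central z s

theorem mul_smul_comm (e : E.groupoid.src s = E.groupoid.tgt t) :
    E.groupoid.mul s (E.smul z t) (e.trans tgt_smul.symm) = E.smul z (E.groupoid.mul s t e) := by
  rw [smul_eq_mul_incl z (E.groupoid.mul s t e), E.groupoid.mul_congr rfl (smul_eq_mul_incl z t),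
    ← E.groupoid.mul_assoc s t _ e (E.tgt_incl _ _).symm]
  exact E.groupoid.mul_congr rfl (by rw [E.groupoid.src_mul]) _

theorem smul_mul_smul (e : E.groupoid.src s = E.groupoid.tgt t) :
    E.groupoid.mul (E.smul z s) (E.smul w t) (src_smul.trans (e.trans tgt_smul.symm)) =
      E.smul (z * w) (E.groupoid.mul s t e) := by
  rw [smul_mul (e.trans tgt_smul.symm), mul_smul_comm e, mul_smul]

theorem smul_left_injective (s : S) : Function.Injective fun z => E.smul z s := fun z w h => by
  have := E.injective_incl (mul_right_cancel h)
  exact congrArg Prod.fst this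

/-- The quotient `t s⁻¹` projects to a unit, so exactness puts it in the circle bundle. -/
theorem exists_smul_eq (h : E.proj s = E.proj t) : ∃ z, E.smul z s = t := by
  have e : E.groupoid.src t = E.groupoid.src s := by rw [← E.src_proj, ← E.src_proj, h]
  have h1 : E.proj (E.groupoid.div t s e) = 𝒢.unit (𝒢.tgt (E.proj s)) := by
    rw [← TopologicalGroupoid.div_self]
    refine eq_div_of_mul_eq (by rw [E.src_proj, E.tgt_proj, src_div]) ?_
    rw [← E.proj_mul _ _ (src_div e), TopologicalGroupoid.div_mul_cancel, h]
  obtain ⟨⟨z, x⟩, hz⟩ := (E.exact _).1 ⟨_, h1⟩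
  have hx : x = E.groupoid.tgt s := by
    rw [← E.src_incl z x, hz, src_div]
  subst hx
  refine ⟨z, ?_⟩
  unfold smul
  rw [E.groupoid.mul_congr hz rfl, TopologicalGroupoid.div_mul_cancel]

theorem continuous_smul : Continuous fun p : Circle × S => E.smul p.1 p.2 :=
  continuous_mul' (E.continuous_incl.comp
    (continuous_fst.prodMk (E.groupoid.continuous_tgt.comp continuous_snd))) continuous_snd _

/-- The saturation of an open set is a union of its circle translates. -/
theorem isOpenMap_proj : IsOpenMap E.proj := fun U hU => by
  rw [← E.isQuotientMap_proj.isOpen_preimage]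
  have : E.proj ⁻¹' (E.proj '' U) = ⋃ z, E.smul z ⁻¹' U := by
    ext s
    simp only [Set.mem_preimage, Set.mem_image, Set.mem_iUnion]
    refine ⟨fun ⟨t, ht, h⟩ => ?_, fun ⟨z, hz⟩ => ⟨_, hz, proj_smul⟩⟩
    obtain ⟨z, rfl⟩ := exists_smul_eq h.symm
    exact ⟨z, ht⟩
  rw [this]
  exact isOpen_iUnion fun z =>
    hU.preimage (continuous_smul.comp (continuous_const.prodMk continuous_id))

end Twist

/-! ### Equivariant functions and local sections -/

/-- The first Fourier coefficient (up to normalization) of a function on the circle. -/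
noncomputable def circleCoeff (h : C(Circle, ℂ)) : ℂ :=
  ∫ θ in (0 : ℝ)..2 * Real.pi, ((Circle.exp θ)⁻¹ : Circle) * h (Circle.exp θ)

theorem continuous_circleCoeff : Continuous circleCoeff := by
  refine intervalIntegral.continuous_parametric_intervalIntegral_of_continuous' ?_ _ _
  have : Continuous fun p : C(Circle, ℂ) × ℝ => p.1 (Circle.exp p.2) := by fun_prop
  exact Continuous.mul (by fun_prop) this

theorem circleCoeff_comp_mul_right (h : C(Circle, ℂ)) (z : Circle) :
    circleCoeff (h.comp ⟨fun w => w * z, by fun_prop⟩) = z * circleCoeff h := by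
  obtain ⟨α, rfl⟩ : ∃ α, Circle.exp α = z := ⟨_, Circle.exp_arg z⟩
  set f : ℝ → ℂ := fun θ => ((Circle.exp θ)⁻¹ : Circle) * h (Circle.exp θ) with hf
  have hper : Function.Periodic f (2 * Real.pi) := fun θ => by
    simp only [hf, Circle.exp_add, Circle.exp_two_pi, mul_one]
  have h1 : circleCoeff (h.comp ⟨fun w => w * Circle.exp α, by fun_prop⟩) =
      ∫ θ in (0 : ℝ)..2 * Real.pi, (Circle.exp α : ℂ) * f (θ + α) := by
    refine intervalIntegral.integral_congr fun θ _ => ?_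
    simp only [hf, Circle.exp_add, ContinuousMap.comp_apply, ContinuousMap.coe_mk, mul_inv,
      Circle.coe_mul, Circle.coe_inv]
    have := Circle.coe_ne_zero (Circle.exp α)
    field_simp
  rw [h1, intervalIntegral.integral_const_mul, intervalIntegral.integral_comp_add_right f α]
  congr 1
  rw [zero_add, add_comm, hper.intervalIntegral_add_eq α 0, zero_add]
  rfl

theorem circleCoeff_coe :
    circleCoeff ⟨fun z => (z : ℂ), by fun_prop⟩ ≠ 0 := by
  have : circleCoeff ⟨fun z => (z : ℂ), by fun_prop⟩ =
      ∫ θ in (0 : ℝ)..2 * Real.pi, (1 : ℂ) := by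
    refine intervalIntegral.integral_congr fun θ _ => ?_
    change (((Circle.exp θ)⁻¹ : Circle) : ℂ) * (Circle.exp θ : ℂ) = 1
    rw [← Circle.coe_mul, inv_mul_cancel, Circle.coe_one]
  rw [this]
  simp [Real.pi_ne_zero]

namespace Twist

variable {X G S : Type*} [TopologicalSpace X] [TopologicalSpace G] [TopologicalSpace S]
  {𝒢 : TopologicalGroupoid X G} {E : Twist 𝒢 S}

/-- The orbit of `s₀` is a copy of the circle, closed in the compact Hausdorff space `OnePoint S`.
Tietze extends its coordinate to a function there, and the first Fourier coefficient along each
orbit makes the extension equivariant. -/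
theorem exists_equivariant (s₀ : S) : ∃ Φ : S → ℂ, Continuous Φ ∧ Φ s₀ ≠ 0 ∧
    ∀ z s, Φ (E.smul z s) = z * Φ s := by
  have := E.t2Space
  have := E.locallyCompactSpace
  let e : Circle → OnePoint S := fun z => (E.smul z s₀ : OnePoint S)
  have he : IsClosedEmbedding e := by
    refine Continuous.isClosedEmbedding ?_ ?_
    · exact OnePoint.continuous_coe.comp
        (continuous_smul.comp (continuous_id.prodMk continuous_const))
    · exact OnePoint.coe_injective.comp (smul_left_injective s₀)
  obtain ⟨h, hh⟩ := ContinuousMap.exists_extension' he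
    (⟨fun z => (z : ℂ), by fun_prop⟩ : C(Circle, ℂ))
  let k : C(S × Circle, ℂ) := ⟨fun p => h (E.smul p.2 p.1 : OnePoint S), h.continuous.comp
    (OnePoint.continuous_coe.comp (continuous_smul.comp continuous_swap))⟩
  refine ⟨fun s => circleCoeff (k.curry s), continuous_circleCoeff.comp k.curry.continuous,
    ?_, fun z s => ?_⟩
  · have : k.curry s₀ = ⟨fun z => (z : ℂ), by fun_prop⟩ := ContinuousMap.ext (congrFun hh)
    simp only [this]
    exact circleCoeff_coe
  · rw [← circleCoeff_comp_mul_right]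
    refine congrArg circleCoeff (ContinuousMap.ext fun w => ?_)
    simp [k, mul_smul]

/-- The projection of a twist has continuous local sections. -/
theorem exists_local_section (r₀ : G) : ∃ (τ : G → S) (U : Set G), IsOpen U ∧ r₀ ∈ U ∧
    ContinuousOn τ U ∧ ∀ r ∈ U, E.proj (τ r) = r := by
  obtain ⟨s₀, rfl⟩ := E.isQuotientMap_proj.surjective r₀
  obtain ⟨Φ, hΦ, h0, hequiv⟩ := exists_equivariant (E := E) s₀
  -- The phase of `Φ` is equivariant where `Φ ≠ 0`, so `(u s)⁻¹ • s` depends only on the fibre of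
  -- `s`.
  let u : S → Circle := fun s => Circle.exp (Φ s).arg
  have hu (s) (h : Φ s ≠ 0) : (u s : ℂ) = Φ s / ‖Φ s‖ := by
    have h' : (‖Φ s‖ : ℂ) ≠ 0 := by simpa using h
    rw [eq_div_iff h', Circle.coe_exp, mul_comm, Complex.norm_mul_exp_arg_mul_I]
  let V : Set S := {s | Φ s ≠ 0}
  have hV : IsOpen V := isOpen_ne_fun hΦ continuous_const
  have hind : IsInducing fun z : Circle => (z : ℂ) := ⟨rfl⟩
  have huV : ContinuousOn u V := by
    rw [hind.continuousOn_iff]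
    refine ContinuousOn.congr (f := fun s => Φ s / ‖Φ s‖) ?_ fun s hs => hu s hs
    exact hΦ.continuousOn.div (by fun_prop) fun s hs => by simpa [V] using hs
  let k : S → S := fun s => E.smul (u s)⁻¹ s
  have hk : ContinuousOn k V := continuous_smul.comp_continuousOn (huV.inv.prodMk continuousOn_id)
  have hkk (s t) (h : E.proj s = E.proj t) (hs : s ∈ V) : t ∈ V ∧ k s = k t := by
    obtain ⟨z, rfl⟩ := exists_smul_eq h
    have ht : Φ (E.smul z s) ≠ 0 := by
      rw [hequiv]
      exact mul_ne_zero z.coe_ne_zero hs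
    refine ⟨ht, ?_⟩
    have : u (E.smul z s) = u s * z := by
      apply Circle.ext
      rw [hu _ ht, Circle.coe_mul, hu _ hs, hequiv]
      rw [norm_mul, Circle.norm_coe, one_mul, mul_div_assoc, mul_comm]
    simp only [k, this, ← mul_smul]
    simp
  let τ : G → S := fun r => k (Function.surjInv E.isQuotientMap_proj.surjective r)
  have hinv (r) : E.proj (Function.surjInv E.isQuotientMap_proj.surjective r) = r :=
    Function.surjInv_eq _ r
  have hτ (s) (hs : s ∈ V) : τ (E.proj s) = k s := (hkk s _ (hinv _).symm hs).2.symm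
  refine ⟨τ, E.proj '' V, isOpenMap_proj _ hV, ⟨s₀, h0, rfl⟩, ?_, ?_⟩
  · rw [continuousOn_open_iff (isOpenMap_proj _ hV)]
    intro W hW
    have : E.proj '' V ∩ τ ⁻¹' W = E.proj '' (V ∩ k ⁻¹' W) := by
      ext r
      constructor
      · rintro ⟨⟨s, hs, rfl⟩, h⟩
        exact ⟨s, ⟨hs, by rwa [Set.mem_preimage, hτ s hs] at h⟩, rfl⟩
      · rintro ⟨s, ⟨hs, h⟩, rfl⟩
        exact ⟨⟨s, hs, rfl⟩, by rwa [Set.mem_preimage, hτ s hs]⟩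
    rw [this]
    exact isOpenMap_proj _ (hk.isOpen_inter_preimage hV hW)
  · intro r _
    simp only [τ, k, proj_smul, hinv]

end Twist

/-! ### Clopen covers and global lifts -/

/-- A space covered by clopen sets with a hereditary local property is a countable union of such
sets. -/
theorem exists_countable_clopen_cover {X : Type*} [TopologicalSpace X] [T2Space X]
    [LocallyCompactSpace X] [SecondCountableTopology X] [TotallyDisconnectedSpace X]
    (P : Set X → Prop) (hempty : P ∅) (hmono : ∀ A B, A ⊆ B → P B → P A)
    (hloc : ∀ x, ∃ U ∈ 𝓝 x, P U) :
    ∃ A : ℕ → Set X, (∀ i, IsClopen (A i)) ∧ (∀ i, P (A i)) ∧ ∀ x, ∃ i, x ∈ A i := by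
  have (x : X) : ∃ A, IsClopen A ∧ P A ∧ x ∈ A := by
    obtain ⟨U, hU, hPU⟩ := hloc x
    obtain ⟨A, hA, hxA, hAU⟩ :=
      loc_compact_Haus_tot_disc_of_zero_dim.mem_nhds_iff.1 hU
    exact ⟨A, hA, hmono A U hAU hPU, hxA⟩
  choose A hA hPA hxA using this
  obtain ⟨s, hs, hcov⟩ := TopologicalSpace.countable_cover_nhds
    fun x => (hA x).isOpen.mem_nhds (hxA x)
  -- Adding `∅` makes the family nonempty, hence the range of a sequence, even when `X` is empty.
  obtain ⟨B, hB⟩ := ((hs.image A).insert ∅).exists_eq_range (Set.insert_nonempty _ _)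
  have hBi (i) : B i = ∅ ∨ ∃ x, A x = B i := by
    have : B i ∈ insert ∅ (A '' s) := hB ▸ Set.mem_range_self i
    exact this.imp id fun ⟨x, _, hx⟩ => ⟨x, hx⟩
  refine ⟨B, fun i => ?_, fun i => ?_, fun x => ?_⟩
  · obtain h | ⟨x, h⟩ := hBi i
    · exact h ▸ isClopen_empty
    · exact h ▸ hA x
  · obtain h | ⟨x, h⟩ := hBi i
    · exact h ▸ hempty
    · exact h ▸ hPA x
  · obtain ⟨y, hy, hxy⟩ := Set.mem_iUnion₂.1 (hcov ▸ Set.mem_univ x)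
    have : A y ∈ Set.range B := hB ▸ Set.mem_insert_of_mem _ ⟨y, hy, rfl⟩
    obtain ⟨i, hi⟩ := this
    exact ⟨i, hi ▸ hxy⟩

/-- The set of points whose first index in a sequence of clopen sets is `i` is open. -/
theorem isOpen_setOf_find_eq {X : Type*} [TopologicalSpace X] {A : ℕ → Set X}
    (hA : ∀ i, IsClopen (A i)) (h : ∀ x, ∃ i, x ∈ A i) (i : ℕ) [∀ x, DecidablePred (x ∈ A ·)] :
    IsOpen {x | Nat.find (h x) = i} := by
  have : {x | Nat.find (h x) = i} = A i ∩ ⋂ j ∈ Set.Iio i, (A j)ᶜ := by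
    ext x
    simp [Nat.find_eq_iff]
  rw [this]
  exact (hA i).isOpen.inter
    ((Set.finite_Iio i).isOpen_biInter fun j _ => (hA j).compl.isOpen)

namespace Twist

variable {X G S : Type*} [TopologicalSpace X] [TopologicalSpace G] [TopologicalSpace S]
  {𝒢 : TopologicalGroupoid X G} (E : Twist 𝒢 S)

theorem exists_lift {Y : Type*} [TopologicalSpace Y] [T2Space Y] [LocallyCompactSpace Y]
    [SecondCountableTopology Y] [TotallyDisconnectedSpace Y] {g : Y → G} (hg : Continuous g) :
    ∃ c : Y → S, Continuous c ∧ ∀ y, E.proj (c y) = g y := by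
  classical
  obtain ⟨A, hA, hP, hcov⟩ := exists_countable_clopen_cover
    -- Assuming `U` nonempty spares the construction of a function into `S` for `U = ∅`.
    (fun U : Set Y => U.Nonempty → ∃ c : Y → S, ContinuousOn c U ∧ ∀ y ∈ U, E.proj (c y) = g y)
    (fun h => (Set.not_nonempty_empty h).elim)
    (fun A B hAB hB hne =>
      let ⟨c, hc, h⟩ := hB (hne.mono hAB)
      ⟨c, hc.mono hAB, fun y hy => h y (hAB hy)⟩)
    (fun y => by
      obtain ⟨τ, U, hU, hyU, hτ, hsec⟩ := exists_local_section (E := E) (g y)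
      exact ⟨g ⁻¹' U, (hU.preimage hg).mem_nhds hyU, fun _ => ⟨τ ∘ g,
        hτ.comp hg.continuousOn fun _ h => h, fun y hy => hsec _ hy⟩⟩)
  choose d hd using hP
  let n (y : Y) : ℕ := Nat.find (hcov y)
  have hn (y) : y ∈ A (n y) := Nat.find_spec (hcov y)
  refine ⟨fun y => d (n y) ⟨y, hn y⟩ y, ?_, fun y => (hd _ _).2 y (hn y)⟩
  refine continuous_iff_continuousAt.2 fun y => ?_
  have h1 : ContinuousAt (d (n y) ⟨y, hn y⟩) y :=
    (hd _ _).1.continuousAt ((hA _).isOpen.mem_nhds (hn y))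
  refine h1.congr ?_
  filter_upwards [(isOpen_setOf_find_eq hA hcov (n y)).mem_nhds rfl] with x hx
  have hx : n x = n y := hx
  have (m) (hm : m = n y) (hx : x ∈ A m) : d (n y) ⟨y, hn y⟩ x = d m ⟨x, hx⟩ x := by
    subst hm
    rfl
  exact this _ hx (hn x)

end Twist

/-! ### Selectors for compact relations -/

namespace EtaleEquivRel

variable {X : Type*} [TopologicalSpace X]

theorem continuous_tgt (L : EtaleEquivRel X) : Continuous (RelPair.tgt : RelPair L.rel → X) :=
  L.groupoid.continuous_tgt

theorem continuous_src (L : EtaleEquivRel X) : Continuous (RelPair.src : RelPair L.rel → X) :=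
  L.groupoid.continuous_src

/-- For a compact étale equivalence relation there is a map that continuously selects a point of
each equivalence class. -/
theorem IsCEER.exists_selector [T2Space X] [LocallyCompactSpace X] [SecondCountableTopology X]
    [TotallyDisconnectedSpace X] {L : EtaleEquivRel X} (hL : L.IsCEER) :
    ∃ (f : X → X) (hf : ∀ x, L.rel x (f x)), (∀ x y, L.rel x y → f x = f y) ∧
      Continuous fun x => (⟨x, f x, hf x⟩ : RelPair L.rel) := by
  classical
  -- This closed set misses the diagonal, so each point has a neighbourhood containing no two
  -- distinct equivalent points.
  have hC : IsClosed ((fun p : RelPair L.rel => (p.tgt, p.src)) '' {p | p.tgt ≠ p.src}) :=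
    (hL.image (L.continuous_tgt.prodMk L.continuous_src)).isClosed
  obtain ⟨A, hA, hP, hcov⟩ := exists_countable_clopen_cover
    (fun U : Set X => ∀ x ∈ U, ∀ y ∈ U, L.rel x y → x = y) (by simp)
    (fun A B hAB hB x hx y hy => hB x (hAB hx) y (hAB hy))
    (fun x => by
      have : (x, x) ∉ (fun p : RelPair L.rel => (p.tgt, p.src)) '' {p | p.tgt ≠ p.src} := by
        rintro ⟨p, hp, h⟩
        exact hp ((congrArg Prod.fst h).trans (congrArg Prod.snd h).symm)
      obtain ⟨U, hU, V, hV, hUV⟩ := mem_nhds_prod_iff.1 (hC.isOpen_compl.mem_nhds this)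
      refine ⟨U ∩ V, Filter.inter_mem hU hV, fun y hy z hz hyz => ?_⟩
      by_contra hne
      exact @hUV (y, z) ⟨hy.1, hz.2⟩ ⟨⟨y, z, hyz⟩, hne, rfl⟩)
  -- the saturation of `A i`
  let B (i : ℕ) : Set X := {x | ∃ y ∈ A i, L.rel x y}
  have hBo (i) : IsOpen (B i) := by
    have : B i = RelPair.tgt '' ((RelPair.src : RelPair L.rel → X) ⁻¹' A i) := by
      ext x
      exact ⟨fun ⟨y, hy, h⟩ => ⟨⟨x, y, h⟩, hy, rfl⟩, fun ⟨p, hp, h⟩ => ⟨p.src, hp, h ▸ p.rel⟩⟩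
    rw [this]
    exact L.isLocalHomeomorph_tgt.isOpenMap _ ((hA i).isOpen.preimage L.continuous_src)
  have hBc (i) : IsClosed (B i) := by
    -- The saturation adds to `A i` only the image of a compact set of off-diagonal pairs.
    have : B i = A i ∪ RelPair.tgt ''
        ({p : RelPair L.rel | p.tgt ≠ p.src} ∩ RelPair.src ⁻¹' A i) := by
      ext x
      constructor
      · rintro ⟨y, hy, h⟩
        by_cases hxy : x = y
        · exact Or.inl (hxy ▸ hy)
        · exact Or.inr ⟨⟨x, y, h⟩, ⟨hxy, hy⟩, rfl⟩
      · rintro (h | ⟨p, hp, h⟩)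
        · exact ⟨x, h, L.rel.refl x⟩
        · exact ⟨p.src, hp.2, h ▸ p.rel⟩
    rw [this]
    exact (hA i).isClosed.union ((hL.inter_right
      ((hA i).isClosed.preimage L.continuous_src)).image L.continuous_tgt).isClosed
  have hBcov (x) : ∃ i, x ∈ B i := (hcov x).imp fun i hi => ⟨x, hi, L.rel.refl x⟩
  -- The index `n x` depends only on the class of `x`, and `f x` is the unique point of that class
  -- in `A (n x)`.
  let n (x : X) : ℕ := Nat.find (hBcov x)
  choose f hfA hf using fun x => Nat.find_spec (hBcov x)
  have huniq (x y i) (hn : n x = i) (hy : y ∈ A i) (hxy : L.rel x y) : f x = y := by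
    subst hn
    exact hP _ _ (hfA x) _ hy (L.rel.trans (L.rel.symm (hf x)) hxy)
  refine ⟨f, hf, fun x y hxy => huniq x _ (n y) ?_ (hfA y) (L.rel.trans hxy (hf y)), ?_⟩
  · refine Nat.find_congr' fun {i} => ?_
    exact ⟨fun ⟨z, hz, h⟩ => ⟨z, hz, L.rel.trans (L.rel.symm hxy) h⟩,
      fun ⟨z, hz, h⟩ => ⟨z, hz, L.rel.trans hxy h⟩⟩
  · refine continuous_def.2 fun W hW => ?_
    have : (fun x => (⟨x, f x, hf x⟩ : RelPair L.rel)) ⁻¹' W =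
        ⋃ i, {x | n x = i} ∩ RelPair.tgt '' (W ∩ RelPair.src ⁻¹' A i) := by
      ext x
      simp only [Set.mem_preimage, Set.mem_iUnion]
      constructor
      · exact fun h => ⟨n x, rfl, _, ⟨h, hfA x⟩, rfl⟩
      · rintro ⟨i, hi, ⟨y, z, hyz⟩, ⟨hpW, hpA⟩, rfl⟩
        have := huniq y z i hi hpA hyz
        subst this
        exact hpW
    rw [this]
    exact isOpen_iUnion fun i => (isOpen_setOf_find_eq (fun i => ⟨hBc i, hBo i⟩) hBcov i).inter
      (L.isLocalHomeomorph_tgt.isOpenMap _ (hW.inter ((hA i).isOpen.preimage L.continuous_src)))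

end EtaleEquivRel

/-! ### Multiplicative sections and triviality -/

namespace Twist

open TopologicalGroupoid

section

variable {X G S : Type*} [TopologicalSpace X] [TopologicalSpace G] [TopologicalSpace S]
  {𝒢 : TopologicalGroupoid X G} {E : Twist 𝒢 S}

theorem src_eq_tgt_of_section {σ : G → S} (hproj : ∀ g, E.proj (σ g) = g) {g h : G}
    (e : 𝒢.src g = 𝒢.tgt h) : E.groupoid.src (σ g) = E.groupoid.tgt (σ h) := by
  rw [← E.src_proj, ← E.tgt_proj, hproj, hproj, e]

/-- A twist with a continuous multiplicative section is trivial. -/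
theorem isTrivial_of_section [T2Space G] [LocallyCompactSpace G] {σ : G → S} (hσ : Continuous σ)
    (hproj : ∀ g, E.proj (σ g) = g)
    (hmul : ∀ g h (e : 𝒢.src g = 𝒢.tgt h), σ (𝒢.mul g h e) =
      E.groupoid.mul (σ g) (σ h) (src_eq_tgt_of_section hproj e)) : E.IsTrivial := by
  have := E.t2Space
  choose ζ hζ using fun s => exists_smul_eq (E := E) (hproj (E.proj s))
  have hζ_eq {s g z} (h : E.smul z (σ g) = s) : ζ s = z := by
    obtain rfl : g = E.proj s := by rw [← h, proj_smul, hproj]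
    exact smul_left_injective _ ((hζ s).trans h.symm)
  -- The graph of `ζ` is closed and the circle is compact, so preimages of closed sets are closed.
  have hcont : Continuous ζ := by
    refine continuous_iff_isClosed.2 fun C hC => ?_
    have h : ζ ⁻¹' C = Prod.fst '' ({p : S × Circle | E.smul p.2 (σ (E.proj p.1)) = p.1} ∩
        Prod.snd ⁻¹' C) := by
      ext s
      constructor
      · exact fun h => ⟨(s, ζ s), ⟨hζ s, h⟩, rfl⟩
      · rintro ⟨⟨s, z⟩, ⟨h, hz⟩, rfl⟩
        simpa [hζ_eq h] using hz
    rw [h]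
    refine isClosedMap_fst_of_compactSpace _ (IsClosed.inter ?_ (hC.preimage continuous_snd))
    exact isClosed_eq (continuous_smul.comp (continuous_snd.prodMk
      (hσ.comp (E.isQuotientMap_proj.continuous.comp continuous_fst)))) continuous_fst
  refine ⟨⟨⟨⟨fun s => (E.proj s, ζ s), fun p => E.smul p.2 (σ p.1), hζ, fun p => ?_⟩,
    E.isQuotientMap_proj.continuous.prodMk hcont,
    continuous_smul.comp (continuous_snd.prodMk (hσ.comp continuous_fst))⟩,
    E.src_proj, E.tgt_proj, fun s t e => ?_, fun p => ?_, fun _ => rfl⟩⟩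
  · exact Prod.ext (proj_smul.trans (hproj _)) (hζ_eq rfl)
  · refine Prod.ext (E.proj_mul s t e) (hζ_eq (z := ζ s * ζ t) (g := 𝒢.mul (E.proj s) (E.proj t)
      ((E.src_proj s).trans (e.trans (E.tgt_proj t).symm))) ?_)
    rw [hmul, ← smul_mul_smul]
    exact E.groupoid.mul_congr (hζ s) (hζ t) _
  · obtain ⟨z, x⟩ := p
    have hu : 𝒢.src (𝒢.unit x) = 𝒢.tgt (𝒢.unit x) := by rw [𝒢.src_unit, 𝒢.tgt_unit]
    have h1 : σ (𝒢.unit x) = E.groupoid.unit x := by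
      have h := hmul (𝒢.unit x) (𝒢.unit x) hu
      rw [unit_mul'] at h
      rw [eq_unit_of_mul_self _ h.symm, ← E.tgt_proj, hproj, 𝒢.tgt_unit]
    refine Prod.ext (proj_incl x) (hζ_eq (z := z) (g := 𝒢.unit x) ?_)
    rw [h1, smul_eq_mul_incl, ← E.groupoid.mul_congr (incl_one x) rfl
      (by rw [E.src_incl, E.tgt_incl, E.groupoid.src_unit])]
    have h2 := E.incl_mul 1 z x
    rw [one_mul] at h2
    rw [h2]
    exact E.groupoid.mul_congr rfl (by rw [E.groupoid.src_unit]) _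

end

section

variable {X S : Type*} [TopologicalSpace X] [TopologicalSpace S] {R : EtaleEquivRel X}
  {E : Twist R.groupoid S}

theorem proj_eq_iff {s : S} {p : RelPair R.rel} :
    E.proj s = p ↔ E.groupoid.tgt s = p.tgt ∧ E.groupoid.src s = p.src := by
  rw [← E.tgt_proj, ← E.src_proj]
  exact RelPair.ext_iff

theorem exists_continuous_section_of_isAF [T2Space X] [LocallyCompactSpace X]
    [SecondCountableTopology X] [TotallyDisconnectedSpace X] (hR : R.IsAF) :
    ∃ (σ : RelPair R.rel → S) (hproj : ∀ p, E.proj (σ p) = p), Continuous σ ∧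
      ∀ p q (e : R.groupoid.src p = R.groupoid.tgt q), σ (R.groupoid.mul p q e) =
        E.groupoid.mul (σ p) (σ q) (src_eq_tgt_of_section hproj e) := by
  obtain ⟨K, mono, le, hK, -, hex, htop⟩ := hR
  have hincl (n) : Continuous (RelPair.inclusion (le n)) :=
    continuous_def.2 fun U hU => (htop U).1 hU n
  choose f hf hinv hfc using fun n => (hK n).exists_selector
  have hlift (n) : ∃ d : X → S, Continuous d ∧ (∀ x, E.groupoid.tgt (d x) = x) ∧
      ∀ x, E.groupoid.src (d x) = f n x := by
    obtain ⟨d, hd, hp⟩ := E.exists_lift ((hincl n).comp (hfc n))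
    exact ⟨d, hd, fun x => (proj_eq_iff.1 (hp x)).1, fun x => (proj_eq_iff.1 (hp x)).2⟩
  choose d hd hdt hds using hlift
  -- lifts of `x ↦ (x, f n x)` that define compatible sections over the relations `K n`
  let T (n : ℕ) := {c : X → S // Continuous c ∧ (∀ x, E.groupoid.tgt (c x) = x) ∧
      ∀ x, E.groupoid.src (c x) = f n x}
  let c (n : ℕ) : T n := Nat.rec ⟨d 0, hd 0, hdt 0, hds 0⟩ (fun n c =>
    -- The source is right because `x` and `f n x` are `K (n + 1)`-equivalent, so `f (n + 1)` agrees
    -- on them.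
    ⟨fun x => E.groupoid.mul (c.1 x) (d (n + 1) (f n x)) ((c.2.2.2 x).trans (hdt _ _).symm),
      continuous_mul' c.2.1 ((hd _).comp ((K n).continuous_src.comp (hfc n))) _,
      fun x => (E.groupoid.tgt_mul _ _ _).trans (c.2.2.1 x),
      fun x => (E.groupoid.src_mul _ _ _).trans ((hds _ _).trans
        (hinv _ _ _ (mono n (hf n x))).symm)⟩) n
  have hsrc {n x y} (h : (K n).rel x y) :
      E.groupoid.src ((c n).1 x) = E.groupoid.src ((c n).1 y) := by
    rw [(c n).2.2.2, (c n).2.2.2, hinv n x y h]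
  have hsucc {n x y} (h : (K n).rel x y) :
      E.groupoid.div ((c (n + 1)).1 x) ((c (n + 1)).1 y) (hsrc (mono n h)) =
        E.groupoid.div ((c n).1 x) ((c n).1 y) (hsrc h) := by
    have h1 : (c (n + 1)).1 y = E.groupoid.mul ((c n).1 y) (d (n + 1) (f n x))
        (((c n).2.2.2 y).trans ((hinv n x y h).symm.trans (hdt _ _).symm)) :=
      E.groupoid.mul_congr rfl (by rw [hinv n x y h]) _
    refine Eq.trans ?_ (mul_div_mul_right (((c n).2.2.2 x).trans (hdt (n + 1) _).symm)
      (((c n).2.2.2 y).trans ((hinv n x y h).symm.trans (hdt _ _).symm)))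
    congr 1
  have hmono {m n} (hmn : m ≤ n) {x y} (h : (K m).rel x y) : ∃ h' : (K n).rel x y,
      E.groupoid.div ((c n).1 x) ((c n).1 y) (hsrc h') =
        E.groupoid.div ((c m).1 x) ((c m).1 y) (hsrc h) := by
    induction n, hmn using Nat.le_induction with
    | base => exact ⟨h, rfl⟩
    | succ n _ ih =>
      obtain ⟨h', e⟩ := ih
      exact ⟨mono n h', (hsucc h').trans e⟩
  -- Any level containing the pair will do: by `hmono` the value of `σ` does not depend on it.
  choose N hN using fun p : RelPair R.rel => hex p.tgt p.src p.rel
  let σ (p : RelPair R.rel) : S :=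
    E.groupoid.div ((c (N p)).1 p.tgt) ((c (N p)).1 p.src) (hsrc (hN p))
  have hσ {n} {p : RelPair R.rel} (h : (K n).rel p.tgt p.src) :
      σ p = E.groupoid.div ((c n).1 p.tgt) ((c n).1 p.src) (hsrc h) := by
    obtain ⟨_, e1⟩ := hmono (le_max_left n (N p)) h
    obtain ⟨_, e2⟩ := hmono (le_max_right n (N p)) (hN p)
    exact e2.symm.trans e1
  have hproj (p) : E.proj (σ p) = p := by
    rw [proj_eq_iff]
    exact ⟨(tgt_div _).trans ((c _).2.2.1 _), (src_div _).trans ((c _).2.2.1 _)⟩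
  refine ⟨σ, hproj, continuous_def.2 fun W hW => (htop _).2 fun n => ?_, fun p q e => ?_⟩
  · have hn : Continuous fun p : RelPair (K n).rel =>
        E.groupoid.div ((c n).1 p.tgt) ((c n).1 p.src) (hsrc p.rel) :=
      continuous_div ((c n).2.1.comp (K n).continuous_tgt)
        ((c n).2.1.comp (K n).continuous_src) _
    convert hW.preimage hn using 1
    ext p
    simp only [Set.mem_preimage]
    rw [hσ (p := RelPair.inclusion (le n) p) p.rel]
    rfl
  · obtain ⟨x, y, hxy⟩ := p
    obtain ⟨y', z, hyz⟩ := q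
    obtain rfl : y = y' := e
    -- At a level containing both pairs, the inner factors `c n y` cancel.
    obtain ⟨h1, -⟩ := hmono (le_max_left (N ⟨x, y, hxy⟩) (N ⟨y, z, hyz⟩)) (hN ⟨x, y, hxy⟩)
    obtain ⟨h2, -⟩ := hmono (le_max_right (N ⟨x, y, hxy⟩) (N ⟨y, z, hyz⟩)) (hN ⟨y, z, hyz⟩)
    rw [E.groupoid.mul_congr (hσ (p := ⟨x, y, hxy⟩) h1) (hσ (p := ⟨y, z, hyz⟩) h2)]
    refine (hσ (p := ⟨x, z, R.rel.trans hxy hyz⟩) ((K _).rel.trans h1 h2)).trans ?_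
    exact (div_mul_div _ _).symm

end

end Twist

theorem proposition4p6 {X : Type*} [TopologicalSpace X] [T2Space X] [LocallyCompactSpace X]
    [SecondCountableTopology X] [TotallyDisconnectedSpace X]
    (R : EtaleEquivRel X) (hR : R.IsAF)
    {S : Type*} [TopologicalSpace S] (E : Twist R.groupoid S) :
    E.IsTrivial := by
  obtain ⟨σ, hproj, hσ, hmul⟩ := Twist.exists_continuous_section_of_isAF (E := E) hR
  exact Twist.isTrivial_of_section hσ hproj hmul
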